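/- A $3$-graph is a collection of $3$-element subsets (edges) of a vertex set. Let $K_t^3$ be the complete $3$-graph on $t$ vertices, and for $s\ge 3$ let the tight cycle $C_s^3$ be the $3$-graph with vertex set $\mathbb{Z}/s\mathbb{Z}$ and edges $\{i,i+1,i+2\}$, $i\in\mathbb{Z}/s\mathbb{Z}$. For $3$-graphs $F,G$, the Ramsey number $r(F,G)$ is the minimum $n$ such that every red/blue coloring of the edges of $K_n^3$ contains a red copy of $F$ or a blue copy of $G$. **Theorem.** Fix $s\ge 5$ with $s\not\equiv 0 \pmod 3$. There are positive constants $a$ and $b$ (depending only on $s$) such that for all integers $t\ge 2$, $$2^{at} < r(C_s^3,K_t^3) < 2^{b t^2\log t}.$$ -/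

import Mathlib

/-- A `k`-uniform hypergraph with vertex set `V`: a collection of `k`-element subsets of `V`. -/
@[ext]
structure KGraph (k : ℕ) (V : Type*) where
  /-- the edges -/
  edges : Set (Finset V)
  /-- every edge has exactly `k` vertices -/
  uniform : ∀ e ∈ edges, e.card = k

namespace KGraph

/-- The complete `k`-graph `K_n^k`, on the vertex set `Fin n`. -/
def complete (k n : ℕ) : KGraph k (Fin n) where
  edges := {e | e.card = k}
  uniform := fun _ he => he

/-- The `k`-sets that are not edges of `H`. -/
def compl {k : ℕ} {V : Type*} (H : KGraph k V) : KGraph k V where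
  edges := {e | e.card = k ∧ e ∉ H.edges}
  uniform := fun _ he => he.1

/-- `H` contains a copy of `F`: an injection of the vertices that maps edges to edges. -/
def ContainsCopy {k : ℕ} {V W : Type*} (H : KGraph k W) (F : KGraph k V) : Prop :=
  ∃ f : V ↪ W, ∀ e ∈ F.edges, e.map f ∈ H.edges

/-- The cyclic interval `{i, i + 1, …, i + k - 1}` of `ZMod s`. -/
def cyclicInterval (k s : ℕ) (i : ZMod s) : Finset (ZMod s) :=
  (Finset.range k).image fun j : ℕ => i + (j : ZMod s)

theorem card_cyclicInterval {k s : ℕ} (h : k ≤ s) (i : ZMod s) :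
    (cyclicInterval k s i).card = k := by
  unfold cyclicInterval
  rw [Finset.card_image_of_injOn, Finset.card_range]
  intro a ha b hb hab
  have ha' : a < k := by simpa using ha
  have hb' : b < k := by simpa using hb
  have hab' : (a : ZMod s) = (b : ZMod s) := add_left_cancel hab
  rw [ZMod.natCast_eq_natCast_iff] at hab'
  exact Nat.ModEq.eq_of_lt_of_lt hab' (ha'.trans_le h) (hb'.trans_le h)

/-- The tight cycle `C_s^k` for `s ≥ k`: its vertices are the integers modulo `s` and its edges
are the cyclic intervals of `k` consecutive vertices. -/
def tightCycle (k s : ℕ) (h : k ≤ s) : KGraph k (ZMod s) where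
  edges := Set.range (cyclicInterval k s)
  uniform := by
    rintro _ ⟨i, rfl⟩
    exact card_cyclicInterval h i

/-- Every red/blue colouring of the edges of `K_n^k` has a red copy of `F` or a blue copy of `G`.
A colouring is given by its `k`-graph `R` of red edges; the blue edges are the other `k`-sets. -/
def Arrows {k : ℕ} {V W : Type*} (n : ℕ) (F : KGraph k V) (G : KGraph k W) : Prop :=
  ∀ R : KGraph k (Fin n), R.ContainsCopy F ∨ R.compl.ContainsCopy G

/-- The Ramsey number `r(F, G)`: the minimum `n` such that every red/blue colouring of `K_n^k`
has a red copy of `F` or a blue copy of `G`. (The value is `0` if there is no such `n`.) -/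
noncomputable def ramsey {k : ℕ} {V W : Type*} (F : KGraph k V) (G : KGraph k W) : ℕ :=
  sInf {n | Arrows n F G}

end KGraph

namespace KGraph

open Finset

/-! Lower bound. Colour the pairs of an ordered set with three colours and make red the triples `x <
y < z` whose pairs `xy`, `yz`, `xz` have colours 0, 1, 2. The colour of a pair then fixes which
positions (lowest, middle, highest) its two vertices take in every red triple through it. Along a
red tight cycle consecutive edges share a pair, so positions repeat with period exactly 3, which
forces `3 ∣ s` (`not_containsCopy_rainbowTriples`). A random colouring has no large blue clique:
`3m` vertices carry `m²` triples with pairwise disjoint sets of pairs, each red with probability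
1/27, and a union bound finishes (`exists_coloring`).

Upper bound. Every tight cycle with `3 ∤ s` maps homomorphically to a fixed `pattern` on five
vertices, so a red blow-up of it suffices. Exposing vertices one at a time shows that `t ^ (3 t²)`
vertices already force a blue clique or a red pattern (`Exposed.exists_clique_or_pattern`). Apply
this to every transversal of that many blocks: by averaging, five blocks carry a positive density of
patterns (`exists_dense_blocks`), and an Erdős box argument turns density into a blow-up
(`exists_box`). Both steps lose only a bounded power of `t ^ t²`. -/

/-! ### Counting colourings -/

/-- A uniform colouring restricted along an injection is uniform; this is the division-free form of
that bound on probabilities. -/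
theorem card_comp_mem_mul_le {α β X : Type*} [Fintype α] [Fintype β] [Fintype X]
    [DecidableEq α] [DecidableEq β] [DecidableEq X]
    (e : β → α) (he : Function.Injective e) (E : Finset (β → X)) :
    #{c : α → X | c ∘ e ∈ E} * Fintype.card X ^ Fintype.card β
      ≤ #E * Fintype.card X ^ Fintype.card α := by
  classical
  have h1 : #{c : α → X | c ∘ e ∈ E}
      ≤ #(E ×ˢ (univ : Finset ({a // a ∉ Set.range e} → X))) := by
    refine card_le_card_of_injOn (fun c => (c ∘ e, fun a => c a)) ?_ ?_
    · intro c hc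
      simpa using hc
    · intro c _ c' _ h
      simp only [Prod.mk.injEq] at h
      funext a
      by_cases ha : a ∈ Set.range e
      · obtain ⟨b, rfl⟩ := ha
        exact congrFun h.1 b
      · exact congrFun h.2 ⟨a, ha⟩
  have h2 : Fintype.card {a // a ∉ Set.range e} + Fintype.card β = Fintype.card α := by
    rw [← Set.card_range_of_injective he, add_comm, ← Fintype.card_sum]
    exact Fintype.card_congr (Equiv.sumCompl (· ∈ Set.range e))
  rw [card_product, card_univ, Fintype.card_fun] at h1
  rw [← h2, pow_add, ← mul_assoc]
  exact Nat.mul_le_mul_right _ h1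

/-- Disjoint triples of cells are coloured independently, and each misses its one prescribed
colouring with probability 26/27. -/
theorem card_avoiding_mul_le {α P : Type*} [Fintype α] [Fintype P]
    [DecidableEq α] [DecidableEq P] (e : P × Fin 3 → α) (he : Function.Injective e) :
    #{c : α → Fin 3 | ∀ p, ∃ k, c (e (p, k)) ≠ k} * 27 ^ Fintype.card P
      ≤ 26 ^ Fintype.card P * 3 ^ Fintype.card α := by
  have h := card_comp_mem_mul_le (X := Fin 3) e he {h | ∀ p, ∃ k, h (p, k) ≠ k}
  have hE : #{h : P × Fin 3 → Fin 3 | ∀ p, ∃ k, h (p, k) ≠ k} ≤ 26 ^ Fintype.card P := by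
    have hsub : #{u : Fin 3 → Fin 3 | ∃ k, u k ≠ k} = 26 := by decide
    calc _ ≤ #(Fintype.piFinset fun _ : P => ({u : Fin 3 → Fin 3 | ∃ k, u k ≠ k} : Finset _)) := by
          refine card_le_card_of_injOn (fun h p k => h (p, k)) ?_ ?_
          · intro h hh
            simpa [Fintype.mem_piFinset] using hh
          · intro h _ h' _ hhh
            funext ⟨p, k⟩
            exact congrFun (congrFun hhh p) k
      _ = _ := by rw [Fintype.card_piFinset, prod_const, hsub, card_univ]
  have h27 : Fintype.card (Fin 3) ^ Fintype.card (P × Fin 3) = 27 ^ Fintype.card P := by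
    rw [Fintype.card_prod, Fintype.card_fin, mul_comm, pow_mul]
    norm_num
  rw [h27] at h
  simp only [mem_filter, mem_univ, true_and, Function.comp_apply, Fintype.card_fin] at h
  exact h.trans (Nat.mul_le_mul_right _ hE)

/-- The pairs spanned by the triples `(i, j, i + j)` of a transversal design. -/
def designPair {n m : ℕ} (g : Fin 3 × Fin m → Fin n) (q : (Fin m × Fin m) × Fin 3) :
    Fin n × Fin n :=
  if q.2 = 0 then (g (0, q.1.1), g (1, q.1.2))
  else if q.2 = 1 then (g (1, q.1.2), g (2, q.1.1 + q.1.2))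
  else (g (0, q.1.1), g (2, q.1.1 + q.1.2))

/-- Any two of `i`, `j`, `i + j` determine the third, so distinct triples share no pair. -/
theorem designPair_injective {n m : ℕ} [NeZero m] (g : Fin 3 × Fin m → Fin n)
    (hg : Function.Injective g) : Function.Injective (designPair g) := by
  rintro ⟨⟨i, j⟩, k⟩ ⟨⟨i', j'⟩, k'⟩ h
  fin_cases k <;> fin_cases k' <;> simp [designPair, hg.eq_iff] at h ⊢ <;> grind

theorem exists_coloring (n m : ℕ) [NeZero m]
    (h : n ^ (3 * m) * 26 ^ (m * m) < 27 ^ (m * m)) :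
    ∃ c : Fin n × Fin n → Fin 3, ∀ g : Fin 3 × Fin m → Fin n, Function.Injective g →
      ∃ i j, c (g (0, i), g (1, j)) = 0 ∧ c (g (1, j), g (2, i + j)) = 1 ∧
        c (g (0, i), g (2, i + j)) = 2 := by
  classical
  by_contra! hcon
  set G : Finset (Fin 3 × Fin m → Fin n) := {g | Function.Injective g} with hG
  have hcover : (univ : Finset (Fin n × Fin n → Fin 3)) ⊆
      G.biUnion fun g => {c | ∀ p, ∃ k, c (designPair g (p, k)) ≠ k} := by
    intro c _
    obtain ⟨g, hg, hc⟩ := hcon c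
    simp only [mem_biUnion, mem_filter, mem_univ, true_and, hG]
    refine ⟨g, hg, fun p => ?_⟩
    by_contra! hp
    have h0 := hp 0
    have h1 := hp 1
    have h2 := hp 2
    simp [designPair] at h0 h1 h2
    exact hc p.1 p.2 h0 h1 h2
  have h1 := (card_le_card hcover).trans card_biUnion_le
  have h2 : ∀ g ∈ G, #{c : Fin n × Fin n → Fin 3 | ∀ p, ∃ k, c (designPair g (p, k)) ≠ k}
      * 27 ^ (m * m) ≤ 26 ^ (m * m) * 3 ^ (n * n) := by
    intro g hg
    have := card_avoiding_mul_le (designPair g) (designPair_injective g (by simpa [hG] using hg))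
    simpa using this
  have h3 : #G ≤ n ^ (3 * m) := by
    refine (card_le_univ G).trans ?_
    simp
  have h4 : 3 ^ (n * n) * 27 ^ (m * m) ≤ n ^ (3 * m) * (26 ^ (m * m) * 3 ^ (n * n)) := by
    calc 3 ^ (n * n) * 27 ^ (m * m)
        ≤ (∑ g ∈ G, #{c : Fin n × Fin n → Fin 3 | ∀ p, ∃ k, c (designPair g (p, k)) ≠ k})
          * 27 ^ (m * m) := by
          refine Nat.mul_le_mul_right _ (le_trans (le_of_eq ?_) h1)
          simp
      _ ≤ ∑ g ∈ G, 26 ^ (m * m) * 3 ^ (n * n) := by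
          rw [sum_mul]
          exact sum_le_sum h2
      _ ≤ _ := by
          rw [sum_const, smul_eq_mul]
          exact Nat.mul_le_mul_right _ h3
  have h5 : 0 < 3 ^ (n * n) := by positivity
  nlinarith

/-! ### Rainbow triples contain no tight cycle of length prime to 3 -/

/-- The triples `x < y < z` whose pairs are coloured `c xy = 0`, `c yz = 1`, `c xz = 2`. -/
def rainbowTriples {n : ℕ} (c : Fin n × Fin n → Fin 3) : KGraph 3 (Fin n) where
  edges := {e | e.card = 3 ∧ ∀ x ∈ e, ∀ y ∈ e, ∀ z ∈ e, x < y → y < z →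
    c (x, y) = 0 ∧ c (y, z) = 1 ∧ c (x, z) = 2}
  uniform := fun _ he => he.1

/-- The position of `x` (lowest, middle, highest) in any rainbow triple through `x` and `y`. -/
def role {n : ℕ} (c : Fin n × Fin n → Fin 3) (x y : Fin n) : Fin 3 :=
  if x < y then (if c (x, y) = 1 then 1 else 0) else (if c (y, x) = 0 then 1 else 2)

theorem role_of_mem {n : ℕ} {c : Fin n × Fin n → Fin 3} {e : Finset (Fin n)}
    (he : e ∈ (rainbowTriples c).edges) {x y z : Fin n} (hx : x ∈ e) (hy : y ∈ e) (hz : z ∈ e)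
    (hxy : x ≠ y) (hxz : x ≠ z) (hyz : y ≠ z) :
    role c x y = role c x z ∧ role c x y ≠ role c y x := by
  have h := he.2
  rcases lt_or_gt_of_ne hxy with h1 | h1 <;> rcases lt_or_gt_of_ne hxz with h2 | h2 <;>
    rcases lt_or_gt_of_ne hyz with h3 | h3
  · have := h x hx y hy z hz h1 h3
    simp [role, h1, h2, not_lt_of_gt, this]
  · have := h x hx z hz y hy h2 h3
    simp [role, h1, h2, not_lt_of_gt, this]
  · exact absurd (h1.trans h3) (not_lt_of_gt h2)
  · have := h z hz x hx y hy h2 h1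
    simp [role, h1, h2, not_lt_of_gt, this]
  · have := h y hy x hx z hz h1 h2
    simp [role, h1, h2, not_lt_of_gt, this]
  · exact absurd (h1.trans h2) (not_lt_of_gt h3)
  · have := h y hy z hz x hx h3 h2
    simp [role, h1, h2, not_lt_of_gt, this]
  · have := h z hz y hy x hx h3 h1
    simp [role, h1, h2, not_lt_of_gt, this]

theorem cyclicInterval_three (s : ℕ) (i : ZMod s) :
    cyclicInterval 3 s i = {i, i + 1, i + 2} := by
  simp [cyclicInterval, range_add_one, insert_comm]
  grind

theorem not_containsCopy_rainbowTriples {n s : ℕ} (c : Fin n × Fin n → Fin 3) (h : 3 ≤ s)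
    (hs3 : ¬ 3 ∣ s) : ¬ (rainbowTriples c).ContainsCopy (tightCycle 3 s h) := by
  rintro ⟨f, hf⟩
  have hedge : ∀ i : ZMod s, ({f i, f (i + 1), f (i + 2)} : Finset (Fin n)) ∈
      (rainbowTriples c).edges := by
    intro i
    have := hf _ ⟨i, rfl⟩
    rw [cyclicInterval_three] at this
    simpa using this
  have hcast : ∀ k : ℕ, 0 < k → k < s → (k : ZMod s) ≠ 0 := by
    intro k h0 hk h
    rw [ZMod.natCast_eq_zero_iff] at h
    exact absurd (Nat.le_of_dvd h0 h) (by omega)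
  have h1 : (1 : ZMod s) ≠ 0 := by exact_mod_cast hcast 1 (by omega) (by omega)
  have h2 : (2 : ZMod s) ≠ 0 := by exact_mod_cast hcast 2 (by omega) (by omega)
  have n01 : ∀ i : ZMod s, f i ≠ f (i + 1) := fun i => by simp [f.injective.eq_iff, h1]
  have n02 : ∀ i : ZMod s, f i ≠ f (i + 2) := fun i => by simp [f.injective.eq_iff, h2]
  have n12 : ∀ i : ZMod s, f (i + 1) ≠ f (i + 2) := fun i => by
    have := n01 (i + 1)
    rwa [add_assoc, one_add_one_eq_two] at this
  set r : ZMod s → Fin 3 := fun i => role c (f i) (f (i + 1)) with hr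
  have e0 : ∀ i, role c (f i) (f (i + 2)) = r i := fun i =>
    ((role_of_mem (hedge i) (by simp) (by simp) (by simp) (n01 i) (n02 i) (n12 i)).1).symm
  have e1 : ∀ i, role c (f (i + 1)) (f i) = r (i + 1) := fun i => by
    have := (role_of_mem (hedge i) (x := f (i + 1)) (y := f i) (z := f (i + 2))
      (by simp) (by simp) (by simp) (n01 i).symm (n12 i) (n02 i)).1
    simp only [hr]
    rw [this, add_assoc, one_add_one_eq_two]
  have e2 : ∀ i, role c (f (i + 2)) (f i) = r (i + 2) := fun i => by
    have := (role_of_mem (hedge i) (x := f (i + 2)) (y := f i) (z := f (i + 1))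
      (by simp) (by simp) (by simp) (n02 i).symm (n12 i).symm (n01 i)).1
    have h' := e1 (i + 1)
    rw [add_assoc, one_add_one_eq_two] at h'
    rw [this, h']
  have d1 : ∀ i, r i ≠ r (i + 1) := fun i => by
    have := (role_of_mem (hedge i) (by simp) (by simp) (by simp) (n01 i) (n02 i) (n12 i)).2
    rwa [e1] at this
  have d2 : ∀ i, r i ≠ r (i + 2) := fun i => by
    have := (role_of_mem (hedge i) (x := f i) (y := f (i + 2)) (z := f (i + 1))
      (by simp) (by simp) (by simp) (n02 i) (n01 i) (n12 i).symm).2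
    rwa [e2, e0] at this
  -- Both `r i` and `r (i + 3)` are the one value in `Fin 3` other than the distinct `r (i + 1)` and
  -- `r (i + 2)`.
  have p3 : ∀ i, r (i + 3) = r i := fun i => by
    have a := d1 i
    have b := d2 i
    have a' := d1 (i + 1)
    have b' := d2 (i + 1)
    have a'' := d1 (i + 2)
    rw [add_assoc] at a' b' a''
    norm_num at a' b' a''
    clear_value r
    omega
  have pk : ∀ k : ℕ, r (3 * (k : ZMod s)) = r 0 := by
    intro k
    induction k with
    | zero => simp
    | succ k ih =>
      have := p3 (3 * (k : ZMod s))
      push_cast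
      rw [mul_add, mul_one, this, ih]
  -- As 3 is invertible modulo `s`, period 3 makes `r 1 = r 0`, against `d1`.
  have hco : Nat.Coprime 3 s := (Nat.Prime.coprime_iff_not_dvd Nat.prime_three).2 hs3
  have : NeZero s := ⟨by omega⟩
  have hinv := ZMod.coe_mul_inv_eq_one 3 hco
  have hk := pk ((3 : ZMod s)⁻¹).val
  rw [ZMod.natCast_zmod_val] at hk
  have h31 : (3 : ZMod s) * 3⁻¹ = 1 := by exact_mod_cast hinv
  rw [h31] at hk
  have := d1 0
  rw [zero_add] at this
  exact this hk.symm

/-! ### Colourings for the lower bound -/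

theorem not_arrows_of_lt {n s t : ℕ} (h : 3 ≤ s) (hn : n < t) :
    ¬ Arrows n (tightCycle 3 s h) (complete 3 t) := by
  intro H
  rcases H ⟨∅, by simp⟩ with ⟨f, hf⟩ | ⟨f, _⟩
  · exact hf _ ⟨0, rfl⟩
  · have := Fintype.card_le_of_embedding f
    simp at this
    omega

theorem not_arrows_of_le_two_pow {n s t k : ℕ} (h : 3 ≤ s) (hs3 : ¬ 3 ∣ s) (hk : 1 ≤ k)
    (hn : n ≤ 2 ^ k) (ht : 180 * k ≤ t) :
    ¬ Arrows n (tightCycle 3 s h) (complete 3 t) := by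
  have : NeZero (60 * k) := ⟨by omega⟩
  obtain ⟨c, hc⟩ := exists_coloring n (60 * k) (by
    -- The union bound with `m = 60 k` and `n ≤ 2 ^ k` reduces to this inequality; it is the source
    -- of 60, hence of 180.
    have h8 : 8 * 26 ^ 60 < 27 ^ 60 := by norm_num
    have h1 : n ^ 3 * 26 ^ (60 * k) < 27 ^ (60 * k) := by
      calc n ^ 3 * 26 ^ (60 * k) ≤ (2 ^ k) ^ 3 * 26 ^ (60 * k) := by gcongr
        _ = (8 * 26 ^ 60) ^ k := by
            rw [mul_pow, ← pow_mul, ← pow_mul, mul_comm k 3, pow_mul 2 3 k]; norm_num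
        _ < (27 ^ 60) ^ k := Nat.pow_lt_pow_left h8 (by omega)
        _ = _ := by rw [← pow_mul]
    calc n ^ (3 * (60 * k)) * 26 ^ (60 * k * (60 * k))
        = (n ^ 3 * 26 ^ (60 * k)) ^ (60 * k) := by rw [mul_pow, ← pow_mul, ← pow_mul]
      _ < (27 ^ (60 * k)) ^ (60 * k) := Nat.pow_lt_pow_left h1 (by omega)
      _ = _ := by rw [← pow_mul])
  intro H
  rcases H (rainbowTriples c) with hF | ⟨f, hf⟩
  · exact not_containsCopy_rainbowTriples c h hs3 hF
  set I : Finset (Fin n) := univ.map f with hI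
  have hIc : I.card = t := by simp [hI]
  set o := I.orderEmbOfFin hIc
  have hlt : ∀ q : Fin 3 × Fin (60 * k), q.1.val * (60 * k) + q.2.val < t := by
    rintro ⟨a, b⟩
    have := a.2
    have := b.2
    have : a.val * (60 * k) ≤ 2 * (60 * k) := Nat.mul_le_mul_right _ (by omega)
    simp only
    omega
  -- The first `180 k` clique vertices in increasing order, cut into three consecutive blocks, so
  -- that every design triple is increasing.
  let g : Fin 3 × Fin (60 * k) → Fin n := fun q => o ⟨_, hlt q⟩
  have hg : Function.Injective g := by
    rintro ⟨a, b⟩ ⟨a', b'⟩ hab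
    have := o.injective hab
    simp only [Fin.mk.injEq] at this
    have hb := b.2
    have hb' := b'.2
    have haa : a = a' := by
      fin_cases a <;> fin_cases a' <;> simp at this ⊢ <;> omega
    subst haa
    simp only [Prod.mk.injEq, true_and]
    ext
    omega
  obtain ⟨i, j, h0, h1, h2⟩ := hc g hg
  have hxy : g (0, i) < g (1, j) := by
    apply o.strictMono
    simp only [Fin.mk_lt_mk]
    have := i.2
    simp
    omega
  have hyz : g (1, j) < g (2, i + j) := by
    apply o.strictMono
    have := j.2
    change 1 * (60 * k) + j.val < 2 * (60 * k) + (i + j).val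
    generalize (i + j).val = u
    omega
  have hmem : ∀ q, ∃ a, f a = g q := by
    intro q
    have : g q ∈ I := I.orderEmbOfFin_mem hIc _
    simpa [hI] using this
  obtain ⟨x, hx⟩ := hmem (0, i)
  obtain ⟨y, hy⟩ := hmem (1, j)
  obtain ⟨z, hz⟩ := hmem (2, i + j)
  have hcard : ({g (0, i), g (1, j), g (2, i + j)} : Finset (Fin n)).card = 3 := by
    rw [card_eq_three]
    exact ⟨_, _, _, hxy.ne, (hxy.trans hyz).ne, hyz.ne, rfl⟩
  have hmap : ({x, y, z} : Finset (Fin t)).map f = {g (0, i), g (1, j), g (2, i + j)} := by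
    simp [hx, hy, hz]
  have := (hf {x, y, z} (by
    change Finset.card _ = 3
    rw [← card_map f, hmap, hcard])).2
  rw [hmap] at this
  refine this ⟨hcard, ?_⟩
  generalize g (0, i) = x' at *
  generalize g (1, j) = y' at *
  generalize g (2, i + j) = z' at *
  intro a ha b hb d hd hab hbd
  simp only [mem_insert, mem_singleton] at ha hb hd
  have hxz := hxy.trans hyz
  obtain ⟨rfl, rfl, rfl⟩ : a = x' ∧ b = y' ∧ d = z' := by
    rcases ha with rfl | rfl | rfl <;> rcases hb with rfl | rfl | rfl <;>
      rcases hd with rfl | rfl | rfl <;> first | exact ⟨rfl, rfl, rfl⟩ | order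
  exact ⟨h0, h1, h2⟩

/-! ### Blue clique or red pattern by vertex exposure -/

/-- The red pattern on five vertices: it maps onto by every tight cycle of length `s ≥ 5`
with `3 ∤ s`. -/
def pattern : Finset (Finset (Fin 5)) :=
  {{0, 1, 2}, {1, 2, 3}, {0, 2, 3}, {0, 1, 3}, {2, 3, 4}, {0, 3, 4}, {0, 1, 4}}

section Exposure

variable {V : Type*} [DecidableEq V]

/-- No triple with two vertices in `X` and the third one in `X ∪ S` belongs to `R`. -/
def BlueOver (R : Set (Finset V)) (X S : Finset V) : Prop :=
  Disjoint X S ∧ ∀ x ∈ X, ∀ y ∈ X, x ≠ y → ∀ z, z ∈ X ∨ z ∈ S → z ≠ x → z ≠ y →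
    ({x, y, z} : Finset V) ∉ R

theorem blueOver_empty (R : Set (Finset V)) (S : Finset V) : BlueOver R ∅ S := by
  simp [BlueOver]

theorem BlueOver.mono {R : Set (Finset V)} {X S S' : Finset V} (h : BlueOver R X S)
    (hS : S' ⊆ S) : BlueOver R X S' :=
  ⟨h.1.mono_right hS, fun x hx y hy hxy z hz => h.2 x hx y hy hxy z (hz.imp_right (@hS z))⟩

theorem triple_swap (x y z : V) : ({x, y, z} : Finset V) = {y, x, z} := insert_comm _ _ _

theorem triple_swap_right (x y z : V) : ({x, y, z} : Finset V) = {x, z, y} := by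
  rw [pair_comm]

/-- Only triples `x v z` with `z ∈ S'` need checking: those inside `insert v X` were already blue
because `v` came from `S`. -/
theorem BlueOver.insert {R : Set (Finset V)} {X S S' : Finset V} {v : V} (h : BlueOver R X S)
    (hS : S' ⊆ S) (hv : v ∈ S) (hv' : v ∉ S')
    (hb : ∀ x ∈ X, ∀ z ∈ S', ({x, v, z} : Finset V) ∉ R) : BlueOver R (insert v X) S' := by
  refine ⟨?_, ?_⟩
  · rw [disjoint_insert_left]
    exact ⟨hv', h.1.mono_right hS⟩
  · intro x hx y hy hxy z hz hzx hzy
    rw [mem_insert] at hx hy hz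
    rcases hx with rfl | hx
    · rcases hy with rfl | hy
      · exact absurd rfl hxy
      rcases hz with (rfl | hz) | hz
      · exact absurd rfl hzx
      · rw [triple_swap, triple_swap_right]
        exact h.2 y hy z hz hzy.symm x (Or.inr hv) hxy hzx.symm
      · rw [triple_swap]
        exact hb y hy z hz
    · rcases hy with rfl | hy
      · rcases hz with (rfl | hz) | hz
        · exact absurd rfl hzy
        · rw [triple_swap_right]
          exact h.2 x hx z hz hzx.symm y (Or.inr hv) hxy.symm hzy.symm
        · exact hb x hx z hz
      · refine h.2 x hx y hy hxy z ?_ hzx hzy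
        rcases hz with (rfl | hz) | hz
        · exact Or.inr hv
        · exact Or.inl hz
        · exact Or.inr (hS hz)

theorem BlueOver.exists_clique {R : Set (Finset V)} {X S : Finset V} {t : ℕ}
    (h : BlueOver R X S) (ht : t ≤ #X) :
    ∃ B : Finset V, #B = t ∧ ∀ e ⊆ B, #e = 3 → e ∉ R := by
  obtain ⟨B, hBX, hB⟩ := exists_subset_card_eq ht
  refine ⟨B, hB, fun e he hc => ?_⟩
  obtain ⟨x, y, z, hxy, hxz, hyz, rfl⟩ := card_eq_three.1 hc
  have hX := he.trans hBX
  exact h.2 x (hX (by simp)) y (hX (by simp)) hxy z (Or.inl (hX (by simp))) hxz.symm hyz.symm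

open scoped Classical in
/-- One of few pairs `xv` is red towards many vertices of `S`, or all of them are blue towards
many. -/
theorem exists_red_or_blue (R : Set (Finset V)) (X S : Finset V) (v : V) {t : ℕ} (hX : #X < t) :
    (∃ x ∈ X, #S ≤ t * #{z ∈ S | ({x, v, z} : Finset V) ∈ R}) ∨
      #S ≤ t * #{z ∈ S | ∀ x ∈ X, ({x, v, z} : Finset V) ∉ R} := by
  by_contra! hcon
  obtain ⟨hr, hb⟩ := hcon
  have hcov : S ⊆ (X.biUnion fun x => {z ∈ S | ({x, v, z} : Finset V) ∈ R}) ∪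
      {z ∈ S | ∀ x ∈ X, ({x, v, z} : Finset V) ∉ R} := by
    intro z hz
    simp only [mem_union, mem_biUnion, mem_filter]
    by_cases h : ∃ x ∈ X, ({x, v, z} : Finset V) ∈ R
    · obtain ⟨x, hx, h⟩ := h
      exact Or.inl ⟨x, hx, hz, h⟩
    · push Not at h
      exact Or.inr ⟨hz, h⟩
  have h1 := (card_le_card hcov).trans (card_union_le _ _)
  have h2 : t * #(X.biUnion fun x => {z ∈ S | ({x, v, z} : Finset V) ∈ R}) ≤ #X * #S := by
    calc _ ≤ t * ∑ x ∈ X, #{z ∈ S | ({x, v, z} : Finset V) ∈ R} :=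
          Nat.mul_le_mul_left _ card_biUnion_le
      _ = ∑ x ∈ X, t * #{z ∈ S | ({x, v, z} : Finset V) ∈ R} := mul_sum _ _ _
      _ ≤ ∑ x ∈ X, #S := sum_le_sum fun x hx => (hr x hx).le
      _ = _ := by simp
  have h3 : (#X + 1) * #S ≤ t * #S := Nat.mul_le_mul_right _ hX
  have h4 := Nat.mul_le_mul_left t h1
  rw [mul_add] at h4
  linarith

/-- The state of the vertex exposure: `A` is a blue list, each `L a` is a blue list of red
neighbours of `a`, and `W` is a blue list of last vertices of red triangles. -/
structure Exposed (R : Set (Finset V)) (A W : Finset V) (L : V → Finset V) (S : Finset V) :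
    Prop where
  blueA : BlueOver R A S
  blueW : BlueOver R W S
  blueL : ∀ a ∈ A, BlueOver R (L a) S
  redL : ∀ a ∈ A, ∀ b ∈ L a, a ≠ b ∧ ∀ z ∈ S, ({a, b, z} : Finset V) ∈ R
  redW : ∀ w ∈ W, ∃ a b, a ≠ b ∧ a ≠ w ∧ b ≠ w ∧ a ∉ S ∧ b ∉ S ∧ ({a, b, w} : Finset V) ∈ R ∧
    ∀ z ∈ S, ({a, b, z} : Finset V) ∈ R ∧ ({a, w, z} : Finset V) ∈ R ∧
      ({b, w, z} : Finset V) ∈ R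

theorem Exposed.mono {R : Set (Finset V)} {A W : Finset V} {L : V → Finset V} {S S' : Finset V}
    (h : Exposed R A W L S) (hS : S' ⊆ S) : Exposed R A W L S' where
  blueA := h.blueA.mono hS
  blueW := h.blueW.mono hS
  blueL := fun a ha => (h.blueL a ha).mono hS
  redL := fun a ha b hb => ⟨(h.redL a ha b hb).1, fun z hz => (h.redL a ha b hb).2 z (hS hz)⟩
  redW := fun w hw => by
    obtain ⟨a, b, h1, h2, h3, h4, h5, h6, h7⟩ := h.redW w hw
    exact ⟨a, b, h1, h2, h3, fun h => h4 (hS h), fun h => h5 (hS h), h6, fun z hz => h7 z (hS hz)⟩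

/-- If `ab` is the pair behind `w`, then `a, b, v, w, z` play `0, 1, 2, 3, 4`: `redW` supplies every
edge except `vwz`, which is `hr`. Hence, short of a pattern, `W` extends with no loss in `S`. -/
theorem Exposed.exists_pattern {R : Set (Finset V)} {A W : Finset V} {L : V → Finset V}
    {S : Finset V} (h : Exposed R A W L S) {w v z : V} (hw : w ∈ W) (hv : v ∈ S) (hz : z ∈ S)
    (hvz : v ≠ z) (hr : ({w, v, z} : Finset V) ∈ R) :
    ∃ p : Fin 5 → V, Function.Injective p ∧ ∀ e ∈ pattern, e.image p ∈ R := by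
  obtain ⟨a, b, hab, haw, hbw, haS, hbS, habw, hS⟩ := h.redW w hw
  obtain ⟨v1, v2, v3⟩ := hS v hv
  obtain ⟨z1, z2, z3⟩ := hS z hz
  have hwS : w ∉ S := disjoint_left.1 h.blueW.1 hw
  have hav : a ≠ v := fun h => haS (h ▸ hv)
  have hbv : b ≠ v := fun h => hbS (h ▸ hv)
  have hwv : w ≠ v := fun h => hwS (h ▸ hv)
  have haz : a ≠ z := fun h => haS (h ▸ hz)
  have hbz : b ≠ z := fun h => hbS (h ▸ hz)
  have hwz : w ≠ z := fun h => hwS (h ▸ hz)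
  refine ⟨![a, b, v, w, z], ?_, ?_⟩
  · intro i j hij
    fin_cases i <;> fin_cases j <;> simp_all [eq_comm]
  · intro e he
    simp only [pattern, mem_insert, mem_singleton] at he
    rcases he with rfl | rfl | rfl | rfl | rfl | rfl | rfl <;> simp [image_insert]
    · exact v1
    · rwa [triple_swap_right]
    · rwa [triple_swap_right]
    · exact habw
    · rwa [triple_swap]
    · exact z2
    · exact z1

theorem Exposed.insertA {R : Set (Finset V)} {A W : Finset V} {L : V → Finset V}
    {S S' : Finset V} (h : Exposed R A W L S) (hS : S' ⊆ S) {v : V} (hv : v ∈ S) (hv' : v ∉ S')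
    (hb : ∀ x ∈ A, ∀ z ∈ S', ({x, v, z} : Finset V) ∉ R) :
    Exposed R (insert v A) W (Function.update L v ∅) S' where
  blueA := h.blueA.insert hS hv hv' hb
  blueW := h.blueW.mono hS
  blueL := fun a ha => by
    by_cases hav : a = v
    · subst hav
      simpa using blueOver_empty R S'
    · rw [Function.update_of_ne hav]
      exact (h.mono hS).blueL a ((mem_insert.1 ha).resolve_left hav)
  redL := fun a ha b hb => by
    by_cases hav : a = v
    · subst hav
      simp at hb
    · rw [Function.update_of_ne hav] at hb
      exact (h.mono hS).redL a ((mem_insert.1 ha).resolve_left hav) b hb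
  redW := (h.mono hS).redW

theorem Exposed.insertL {R : Set (Finset V)} {A W : Finset V} {L : V → Finset V}
    {S S' : Finset V} (h : Exposed R A W L S) (hS : S' ⊆ S) {v x : V} (hv : v ∈ S) (hv' : v ∉ S')
    (hx : x ∈ A) (hr : ∀ z ∈ S', ({x, v, z} : Finset V) ∈ R)
    (hb : ∀ y ∈ L x, ∀ z ∈ S', ({y, v, z} : Finset V) ∉ R) :
    Exposed R A W (Function.update L x (insert v (L x))) S' where
  blueA := h.blueA.mono hS
  blueW := h.blueW.mono hS
  blueL := fun a ha => by
    by_cases hav : a = x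
    · subst hav
      simpa using (h.blueL a ha).insert hS hv hv' hb
    · rw [Function.update_of_ne hav]
      exact (h.mono hS).blueL a ha
  redL := fun a ha b hb => by
    by_cases hav : a = x
    · subst hav
      rw [Function.update_self, mem_insert] at hb
      rcases hb with rfl | hb
      · exact ⟨fun hab => disjoint_left.1 h.blueA.1 ha (hab ▸ hv), hr⟩
      · exact (h.mono hS).redL a ha b hb
    · rw [Function.update_of_ne hav] at hb
      exact (h.mono hS).redL a ha b hb
  redW := (h.mono hS).redW

theorem Exposed.insertW {R : Set (Finset V)} {A W : Finset V} {L : V → Finset V}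
    {S S' : Finset V} (h : Exposed R A W L S) (hS : S' ⊆ S) {v x y : V} (hv : v ∈ S)
    (hv' : v ∉ S') (hx : x ∈ A) (hy : y ∈ L x) (hr : ∀ z ∈ S', ({x, v, z} : Finset V) ∈ R)
    (hr' : ∀ z ∈ S', ({y, v, z} : Finset V) ∈ R)
    (hb : ∀ w ∈ W, ∀ z ∈ S', ({w, v, z} : Finset V) ∉ R) :
    Exposed R A (insert v W) L S' where
  blueA := h.blueA.mono hS
  blueW := h.blueW.insert hS hv hv' hb
  blueL := (h.mono hS).blueL
  redL := (h.mono hS).redL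
  redW := fun w hw => by
    rcases mem_insert.1 hw with rfl | hw
    · have hxS := disjoint_left.1 h.blueA.1 hx
      have hyS := disjoint_left.1 (h.blueL x hx).1 hy
      obtain ⟨hxy, hxyz⟩ := h.redL x hx y hy
      exact ⟨x, y, hxy, fun h => hxS (h ▸ hv), fun h => hyS (h ▸ hv), fun h => hxS (hS h),
        fun h => hyS (hS h), hxyz w hv, fun z hz => ⟨hxyz z (hS hz), hr z hz, hr' z hz⟩⟩
    · exact (h.mono hS).redW w hw

/-- Each exposed vertex `v` joins one list: `A` if blue to all of it; else it is red with some `x ∈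
A` and joins `L x` if blue to that list; else it closes a red triangle `x y v` and joins `W`. Lists
shorter than `t` have total size below `t²`, so `t²` exposures suffice. -/
theorem Exposed.exists_clique_or_pattern {R : Set (Finset V)} {t : ℕ} (ht : 2 ≤ t) (n : ℕ)
    {A W : Finset V} {L : V → Finset V} {S : Finset V} (h : Exposed R A W L S)
    (hn : t ^ 2 ≤ #A + #W + ∑ a ∈ A, #(L a) + n) (hS : (t ^ 3) ^ n ≤ #S) :
    (∃ B : Finset V, #B = t ∧ ∀ e ⊆ B, #e = 3 → e ∉ R) ∨
      ∃ p : Fin 5 → V, Function.Injective p ∧ ∀ e ∈ pattern, e.image p ∈ R := by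
  classical
  induction n generalizing A W L S with
  | zero =>
    left
    by_cases hA : t ≤ #A
    · exact h.blueA.exists_clique hA
    by_cases hW : t ≤ #W
    · exact h.blueW.exists_clique hW
    by_cases hL : ∃ a ∈ A, t ≤ #(L a)
    · obtain ⟨a, ha, hL⟩ := hL
      exact (h.blueL a ha).exists_clique hL
    push Not at hL
    exfalso
    -- The total is at most `(t - 1) + (t - 1) + (t - 1)² = t² - 1`.
    obtain ⟨u, rfl⟩ : ∃ u, t = u + 1 := ⟨t - 1, by omega⟩
    have h1 : ∑ a ∈ A, #(L a) ≤ #A * u := by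
      rw [← smul_eq_mul]
      exact sum_le_card_nsmul _ _ _ fun a ha => Nat.le_of_lt_succ (hL a ha)
    have h2 : #A * u ≤ u * u := Nat.mul_le_mul_right _ (by omega)
    have : (u + 1) ^ 2 = u * u + 2 * u + 1 := by ring
    omega
  | succ n ih =>
    by_cases hA : t ≤ #A
    · exact Or.inl (h.blueA.exists_clique hA)
    by_cases hL : ∃ a ∈ A, t ≤ #(L a)
    · obtain ⟨a, ha, hL⟩ := hL
      exact Or.inl ((h.blueL a ha).exists_clique hL)
    push Not at hL hA
    -- Of the factor `t ^ 3` per exposure, two powers pay for the two pigeonhole choices and the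
    -- third, being at least 2, for erasing `v`.
    have ht3 : 2 * (t * t) ≤ t ^ 3 := by
      rw [pow_succ, pow_two, mul_comm]
      exact Nat.mul_le_mul_left _ ht
    have hS2 : 2 * (t * t * (t ^ 3) ^ n) ≤ #S := by
      refine le_trans ?_ hS
      rw [pow_succ (t ^ 3) n, mul_comm ((t ^ 3) ^ n), ← mul_assoc]
      exact Nat.mul_le_mul_right _ ht3
    have htt : 1 ≤ t * t * (t ^ 3) ^ n := Nat.one_le_iff_ne_zero.2 (by positivity)
    obtain ⟨v, hv⟩ : S.Nonempty := card_pos.1 (by omega)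
    set S₁ := S.erase v with hS₁
    have hS₁S : S₁ ⊆ S := erase_subset _ _
    have hvS₁ : v ∉ S₁ := by simp [hS₁]
    have hc₁ : t * t * (t ^ 3) ^ n ≤ #S₁ := by
      rw [hS₁, card_erase_of_mem hv]
      omega
    by_cases hwz : ∃ w ∈ W, ∃ z ∈ S₁, ({w, v, z} : Finset V) ∈ R
    · obtain ⟨w, hw, z, hz, hr⟩ := hwz
      exact Or.inr (h.exists_pattern hw hv (hS₁S hz) (fun h => hvS₁ (h ▸ hz)) hr)
    push Not at hwz
    have hpass : ∀ {S' : Finset V}, t * (t ^ 3) ^ n ≤ t * #S' → (t ^ 3) ^ n ≤ #S' :=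
      fun h => Nat.le_of_mul_le_mul_left h (by omega)
    rcases exists_red_or_blue R A S₁ v hA with ⟨x, hx, hc₂⟩ | hc₂
    · set S₂ := {z ∈ S₁ | ({x, v, z} : Finset V) ∈ R} with hS₂
      have hS₂S₁ : S₂ ⊆ S₁ := filter_subset _ _
      have hr₂ : ∀ z ∈ S₂, ({x, v, z} : Finset V) ∈ R := fun z hz => (mem_filter.1 hz).2
      have hc₂' : t * (t ^ 3) ^ n ≤ #S₂ :=
        Nat.le_of_mul_le_mul_left (by rw [← mul_assoc]; exact hc₁.trans hc₂) (by omega : 0 < t)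
      rcases exists_red_or_blue R (L x) S₂ v (hL x hx) with ⟨y, hy, hc₃⟩ | hc₃
      · set S₃ := {z ∈ S₂ | ({y, v, z} : Finset V) ∈ R} with hS₃
        have hS₃S₂ : S₃ ⊆ S₂ := filter_subset _ _
        refine ih (h.insertW (hS₃S₂.trans (hS₂S₁.trans hS₁S)) hv
          (fun h => hvS₁ (hS₂S₁ (hS₃S₂ h))) hx hy (fun z hz => hr₂ z (hS₃S₂ hz))
          (fun z hz => (mem_filter.1 hz).2)
          (fun w hw z hz => hwz w hw z (hS₂S₁ (hS₃S₂ hz)))) ?_ (hpass (hc₂'.trans hc₃))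
        rw [card_insert_of_notMem (disjoint_right.1 h.blueW.1 hv)]
        omega
      · set S₃ := {z ∈ S₂ | ∀ y ∈ L x, ({y, v, z} : Finset V) ∉ R} with hS₃
        have hS₃S₂ : S₃ ⊆ S₂ := filter_subset _ _
        refine ih (h.insertL (hS₃S₂.trans (hS₂S₁.trans hS₁S)) hv
          (fun h => hvS₁ (hS₂S₁ (hS₃S₂ h))) hx (fun z hz => hr₂ z (hS₃S₂ hz))
          (fun y hy z hz => (mem_filter.1 hz).2 y hy)) ?_ (hpass (hc₂'.trans hc₃))
        have h1 : ∑ a ∈ A, #(Function.update L x (insert v (L x)) a) =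
            ∑ a ∈ A, #(L a) + 1 := by
          rw [← add_sum_erase _ _ hx, ← add_sum_erase A (fun a => #(L a)) hx,
            Function.update_self,
            card_insert_of_notMem (disjoint_right.1 (h.blueL x hx).1 hv)]
          rw [sum_congr rfl fun a ha => by rw [Function.update_of_ne (ne_of_mem_erase ha)]]
          ring
        omega
    · set S₂ := {z ∈ S₁ | ∀ x ∈ A, ({x, v, z} : Finset V) ∉ R} with hS₂
      have hS₂S₁ : S₂ ⊆ S₁ := filter_subset _ _
      have hc₂' : t * (t ^ 3) ^ n ≤ #S₂ :=
        Nat.le_of_mul_le_mul_left (by rw [← mul_assoc]; exact hc₁.trans hc₂) (by omega : 0 < t)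
      have hvA : v ∉ A := disjoint_right.1 h.blueA.1 hv
      refine ih (h.insertA (hS₂S₁.trans hS₁S) hv (fun h => hvS₁ (hS₂S₁ h))
        (fun x hx z hz => (mem_filter.1 hz).2 x hx)) ?_
        (le_trans (Nat.le_mul_of_pos_left _ (by omega)) hc₂')
      rw [card_insert_of_notMem hvA, sum_insert hvA, Function.update_self, card_empty]
      rw [sum_congr rfl fun a ha => by
        rw [Function.update_of_ne (fun h : a = v => hvA (h ▸ ha))]]
      omega

theorem exists_clique_or_pattern [Fintype V] (R : Set (Finset V)) {t : ℕ} (ht : 2 ≤ t)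
    (hV : (t ^ 3) ^ t ^ 2 ≤ Fintype.card V) :
    (∃ B : Finset V, #B = t ∧ ∀ e ⊆ B, #e = 3 → e ∉ R) ∨
      ∃ p : Fin 5 → V, Function.Injective p ∧ ∀ e ∈ pattern, e.image p ∈ R :=
  Exposed.exists_clique_or_pattern (A := ∅) (W := ∅) (L := fun _ => ∅) (S := univ) ht (t ^ 2)
    ⟨blueOver_empty _ _, blueOver_empty _ _, by simp, by simp, by simp⟩ (by simp) hV

end Exposure

/-! ### From positive density to a blow-up -/

open scoped Classical in
-- At least `|Y| / (2D)` vertices `y` have degree at least `|X| / (2D)`, and each is joined to all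
-- of `f` for at least `(|X| / (4D)) ^ m` injections `f`; averaging over the at most `|X| ^ m`
-- injections gives the bound.
theorem exists_embedding_of_dense {X Y : Type*} [Fintype X] [Fintype Y] [Nonempty X]
    (E : Finset (X × Y)) {D m : ℕ} (hD : 1 ≤ D)
    (hE : Fintype.card X * Fintype.card Y ≤ #E * D) (hm : 4 * D * m ≤ Fintype.card X) :
    ∃ f : Fin m ↪ X, Fintype.card Y ≤ #{y | ∀ i, (f i, y) ∈ E} * (4 * D) ^ (m + 1) := by
  set x := Fintype.card X with hx
  have hx0 : 0 < x := Fintype.card_pos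
  rcases Nat.eq_zero_or_pos (Fintype.card Y) with hY | hY
  · have hmx : m ≤ x := le_trans (Nat.le_mul_of_pos_left _ (by omega)) hm
    obtain ⟨f⟩ := Function.Embedding.nonempty_of_card_le
      (α := Fin m) (β := X) (by simpa using hmx)
    exact ⟨f, by simp [hY]⟩
  set d : Y → ℕ := fun y => #{a : X | (a, y) ∈ E} with hd
  set H : Finset Y := {y | x ≤ 2 * D * d y} with hH
  have hsum : #E = ∑ y, d y := by
    rw [card_eq_sum_card_fiberwise (f := Prod.snd) (t := univ) (by simp)]
    refine sum_congr rfl fun y _ => ?_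
    refine card_bij (fun p _ => p.1) ?_ ?_ ?_
    · rintro ⟨a, b⟩ h
      simp only [mem_filter] at h
      simpa [← h.2] using h.1
    · rintro ⟨a, b⟩ h ⟨a', b'⟩ h' hab
      simp only [mem_filter] at h h'
      simp_all
    · intro a ha
      exact ⟨(a, y), by simpa using ha, rfl⟩
  have hdx : ∀ y, d y ≤ x := fun y => card_le_univ _
  have hHcard : Fintype.card Y ≤ 2 * D * #H := by
    have h1 : 2 * D * ∑ y, d y ≤ 2 * D * x * #H + x * Fintype.card Y := by
      rw [← sum_filter_add_sum_filter_not univ (fun y => x ≤ 2 * D * d y), mul_add]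
      refine add_le_add ?_ ?_
      · rw [mul_assoc (2 * D) x]
        refine Nat.mul_le_mul_left _ ?_
        rw [mul_comm x, ← smul_eq_mul]
        exact sum_le_card_nsmul _ _ _ fun y _ => hdx y
      · rw [mul_sum]
        calc _ ≤ #{y : Y | ¬ x ≤ 2 * D * d y} • x :=
              sum_le_card_nsmul _ _ _ fun y hy => by
                simp only [mem_filter, not_le] at hy
                exact hy.2.le
          _ ≤ _ := by
              rw [smul_eq_mul, mul_comm]
              exact Nat.mul_le_mul_left _ (card_le_univ _)
    rw [hsum] at hE
    have h2 : x * Fintype.card Y ≤ x * (2 * D * #H) := by nlinarith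
    exact Nat.le_of_mul_le_mul_left h2 hx0
  have hcount : ∀ y ∈ H, x ^ m ≤ (4 * D) ^ m * #{f : Fin m ↪ X | ∀ i, (f i, y) ∈ E} := by
    intro y hy
    have hy' : x ≤ 2 * D * d y := by simpa [hH] using hy
    have h1 : (d y).descFactorial m ≤ #{f : Fin m ↪ X | ∀ i, (f i, y) ∈ E} := by
      have : Fintype.card (Fin m ↪ {a : X // (a, y) ∈ E}) = (d y).descFactorial m := by
        rw [Fintype.card_embedding_eq, Fintype.card_fin, Fintype.card_subtype]
      rw [← this, ← card_univ]
      refine card_le_card_of_injOn (fun f => f.trans (Function.Embedding.subtype _)) ?_ ?_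
      · intro f _
        simp only [coe_filter, mem_univ, true_and, Set.mem_ofPred_eq]
        exact fun i => (f i).2
      · intro f _ f' _ hff
        ext i
        exact congrArg (fun g : Fin m ↪ X => g i) hff
    refine le_trans ?_ (Nat.mul_le_mul_left _ (h1.trans' (Nat.pow_sub_le_descFactorial _ _)))
    rw [← mul_pow]
    refine Nat.pow_le_pow_left ?_ _
    -- Here `hm` absorbs the loss of `m` from injectivity, turning `2D` into `4D`.
    rw [Nat.mul_sub]
    have : 4 * D * (d y + 1) = 2 * (2 * D * d y) + 4 * D := by ring
    omega
  by_contra! hcon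
  have hdouble : ∑ f : Fin m ↪ X, #{y | ∀ i, (f i, y) ∈ E} =
      ∑ y, #{f : Fin m ↪ X | ∀ i, (f i, y) ∈ E} := by
    simp only [card_filter]
    exact sum_comm
  have hlow : #H * x ^ m ≤ (4 * D) ^ m * ∑ f : Fin m ↪ X, #{y | ∀ i, (f i, y) ∈ E} := by
    rw [hdouble, mul_sum, ← smul_eq_mul]
    refine (card_nsmul_le_sum H _ _ hcount).trans ?_
    exact sum_le_sum_of_subset (subset_univ H)
  have hupp : (4 * D) ^ (m + 1) * ∑ f : Fin m ↪ X, #{y | ∀ i, (f i, y) ∈ E} ≤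
      x ^ m * Fintype.card Y := by
    rw [mul_sum]
    calc _ ≤ #(univ : Finset (Fin m ↪ X)) • Fintype.card Y :=
          sum_le_card_nsmul _ _ _ fun f _ => by rw [mul_comm]; exact (hcon f).le
      _ ≤ _ := by
          rw [smul_eq_mul, card_univ, Fintype.card_embedding_eq, Fintype.card_fin]
          exact Nat.mul_le_mul_right _ (Nat.descFactorial_le_pow _ _)
  have hxm : 0 < x ^ m := by positivity
  have h1 : 4 * D * (#H * x ^ m) ≤ x ^ m * Fintype.card Y := by
    refine le_trans (Nat.mul_le_mul_left _ hlow) (le_trans (le_of_eq ?_) hupp)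
    ring
  have h2 : x ^ m * (2 * Fintype.card Y) ≤ x ^ m * Fintype.card Y := by
    refine le_trans ?_ h1
    calc x ^ m * (2 * Fintype.card Y) ≤ x ^ m * (2 * (2 * D * #H)) := by gcongr
      _ = _ := by ring
  have := Nat.le_of_mul_le_mul_left h2 hxm
  omega

/-- Induction on `k`: choose `m` values of the first coordinate with a dense common link, then
recurse in the link. The exponent `d` becomes `(d + 2) * (m + 1)`, where `+ 2` absorbs the factor `4
≤ T ^ 2`; `e` does not depend on `T`. -/
theorem exists_box (m k d : ℕ) : ∃ e, ∀ T, 2 ≤ T → ∀ M, T ^ e ≤ M →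
    ∀ E : Finset (Fin k → Fin M), M ^ k ≤ #E * T ^ d →
      ∃ f : Fin k → Fin m ↪ Fin M, ∀ y : Fin k → Fin m, (fun i => f i (y i)) ∈ E := by
  classical
  induction k generalizing d with
  | zero =>
    refine ⟨0, fun T _ M _ E hE => ⟨Fin.elim0, fun y => ?_⟩⟩
    have hne : E.Nonempty := card_pos.1 (Nat.pos_of_ne_zero fun h => by simp [h] at hE)
    obtain ⟨u, hu⟩ := hne
    convert hu
  | succ k ih =>
    obtain ⟨e', he'⟩ := ih ((d + 2) * (m + 1))
    refine ⟨max e' (d + 2 + m), fun T hT M hM E hE => ?_⟩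
    have hT1 : 1 ≤ T := by omega
    have hM' : T ^ e' ≤ M := (Nat.pow_le_pow_right hT1 (le_max_left _ _)).trans hM
    have h4 : 4 * T ^ d ≤ T ^ (d + 2) := by
      rw [pow_add, mul_comm]
      exact Nat.mul_le_mul_left _ (Nat.pow_le_pow_left hT 2)
    have hm : 4 * T ^ d * m ≤ M := by
      refine le_trans ?_ ((Nat.pow_le_pow_right hT1 (le_max_right e' (d + 2 + m))).trans hM)
      rw [pow_add T (d + 2) m]
      exact Nat.mul_le_mul h4 (Nat.lt_two_pow_self.le.trans (Nat.pow_le_pow_left hT m))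
    have hM0 : 0 < M := lt_of_lt_of_le (by positivity) hM
    have : Nonempty (Fin M) := ⟨⟨0, hM0⟩⟩
    obtain ⟨f₀, hf₀⟩ := exists_embedding_of_dense (m := m) (D := T ^ d)
      (E.map (Fin.consEquiv fun _ : Fin (k + 1) => Fin M).symm.toEmbedding)
      (Nat.one_le_pow _ _ hT1)
      (by rw [card_map]; simpa [pow_succ, mul_comm] using hE) (by simpa using hm)
    obtain ⟨f, hf⟩ := he' T hT M hM' _ (by
      have h5 : (4 * T ^ d) ^ (m + 1) ≤ T ^ ((d + 2) * (m + 1)) := by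
        rw [pow_mul]
        exact Nat.pow_le_pow_left h4 _
      refine le_trans ?_ (Nat.mul_le_mul_left _ h5)
      simpa using hf₀)
    refine ⟨Fin.cons f₀ f, fun y => ?_⟩
    have := hf fun i => y i.succ
    simp only [mem_filter, mem_univ, true_and] at this
    have := this (y 0)
    convert this using 1
    funext i
    refine Fin.cases ?_ (fun i => ?_) i <;> simp [Fin.consEquiv]

/-- If every transversal of `N` blocks of size `M` has an admissible `k`-tuple, then some
`k`-tuple of blocks has many admissible `k`-tuples. -/
theorem exists_dense_blocks {k N M : ℕ} (hM : 0 < M)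
    (E : (Fin k → Fin N) → Finset (Fin k → Fin M))
    (h : ∀ g : Fin N → Fin M, ∃ p : Fin k → Fin N, Function.Injective p ∧ g ∘ p ∈ E p) :
    ∃ p : Fin k → Fin N, Function.Injective p ∧ M ^ k ≤ #(E p) * N ^ k := by
  classical
  by_contra! hcon
  set P : Finset (Fin k → Fin N) := {p | Function.Injective p} with hP
  have hcov : (univ : Finset (Fin N → Fin M)) ⊆ P.biUnion fun p => {g | g ∘ p ∈ E p} := by
    intro g _
    obtain ⟨p, hp, hg⟩ := h g
    simp only [mem_biUnion, mem_filter, mem_univ, true_and, hP]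
    exact ⟨p, hp, hg⟩
  have hPne : P.Nonempty := by
    obtain ⟨p, hp, _⟩ := h fun _ => ⟨0, hM⟩
    exact ⟨p, by simpa [hP] using hp⟩
  have h1 : M ^ N ≤ ∑ p ∈ P, #{g : Fin N → Fin M | g ∘ p ∈ E p} := by
    have := (card_le_card hcov).trans card_biUnion_le
    simpa using this
  -- A random transversal is admissible at `p` with probability at most `#(E p) / M ^ k`, and there
  -- are at most `N ^ k` choices of `p`.
  have h2 : ∀ p ∈ P, #{g : Fin N → Fin M | g ∘ p ∈ E p} * M ^ k * N ^ k < M ^ k * M ^ N := by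
    intro p hp
    have hp' : Function.Injective p := by simpa [hP] using hp
    have h3 := card_comp_mem_mul_le p hp' (E p)
    simp only [Fintype.card_fin] at h3
    calc _ ≤ #(E p) * M ^ N * N ^ k := Nat.mul_le_mul_right _ h3
      _ = (#(E p) * N ^ k) * M ^ N := by ring
      _ < _ := Nat.mul_lt_mul_of_pos_right (hcon p hp') (by positivity)
  have h4 : M ^ N * (M ^ k * N ^ k) < #P * (M ^ k * M ^ N) := by
    calc _ ≤ ∑ p ∈ P, #{g : Fin N → Fin M | g ∘ p ∈ E p} * M ^ k * N ^ k := by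
          simp only [mul_assoc]
          rw [← sum_mul]
          exact Nat.mul_le_mul_right _ h1
      _ < ∑ p ∈ P, M ^ k * M ^ N := sum_lt_sum_of_nonempty hPne h2
      _ = _ := by simp
  have h5 : #P ≤ N ^ k := (card_le_univ P).trans (by simp)
  have h6 := Nat.mul_le_mul_right (M ^ k * M ^ N) h5
  have : M ^ N * (M ^ k * N ^ k) = N ^ k * (M ^ k * M ^ N) := by ring
  omega

/-! ### Tight cycles map to the pattern -/

/-- The map from `ZMod s`, `s = 3 q + 1` or `s = 3 q + 2`, to the vertices of the pattern. -/
def label (q n : ℕ) : Fin 5 :=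
  if n < 3 * q then (if n % 3 = 0 then 0 else if n % 3 = 1 then 1 else 2)
  else if n = 3 * q then 3 else 4

/-- The closed walk is `012…012` followed by `3` or by `34`. The former uses the four triples in
`{0, 1, 2, 3}`; the latter uses `012`, `123`, `234`, `034`, `014`. -/
theorem label_mem_pattern {q s v : ℕ} (hq : 1 ≤ q) (hs : s = 3 * q + 1 ∨ s = 3 * q + 2)
    (hv : v < s) :
    ({label q v, label q ((v + 1) % s), label q ((v + 2) % s)} : Finset (Fin 5)) ∈ pattern := by
  have l0 : ∀ n, n < 3 * q → n % 3 = 0 → label q n = 0 := by grind [label]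
  have l1 : ∀ n, n < 3 * q → n % 3 = 1 → label q n = 1 := by grind [label]
  have l2 : ∀ n, n < 3 * q → n % 3 = 2 → label q n = 2 := by grind [label]
  have l3 : label q (3 * q) = 3 := by simp [label]
  have l4 : label q (3 * q + 1) = 4 := by simp [label]
  have z0 := l0 0 (by omega) rfl
  have z1 := l1 1 (by omega) rfl
  obtain h | h | h | h | h : v + 2 < 3 * q ∨ v + 2 = 3 * q ∨ v + 1 = 3 * q ∨ v = 3 * q ∨
    v = 3 * q + 1 := by omega
  · rw [Nat.mod_eq_of_lt (by omega : v + 1 < s), Nat.mod_eq_of_lt (by omega : v + 2 < s)]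
    obtain hm | hm | hm : v % 3 = 0 ∨ v % 3 = 1 ∨ v % 3 = 2 := by omega
    · rw [l0 v (by omega) hm, l1 (v + 1) (by omega) (by omega), l2 (v + 2) h (by omega)]
      decide
    · rw [l1 v (by omega) hm, l2 (v + 1) (by omega) (by omega), l0 (v + 2) h (by omega)]
      decide
    · rw [l2 v (by omega) hm, l0 (v + 1) (by omega) (by omega), l1 (v + 2) h (by omega)]
      decide
  · rw [Nat.mod_eq_of_lt (by omega : v + 1 < s), Nat.mod_eq_of_lt (by omega : v + 2 < s), h, l3,
      l1 v (by omega) (by omega), l2 (v + 1) (by omega) (by omega)]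
    decide
  · rw [Nat.mod_eq_of_lt (by omega : v + 1 < s), h, l3, l2 v (by omega) (by omega)]
    rcases hs with rfl | rfl
    · rw [show v + 2 = 3 * q + 1 by omega, Nat.mod_self, z0]
      decide
    · rw [show v + 2 = 3 * q + 1 by omega, Nat.mod_eq_of_lt (by omega), l4]
      decide
  · subst h
    rw [l3]
    rcases hs with rfl | rfl
    · rw [Nat.mod_self, z0, show 3 * q + 2 = 1 + (3 * q + 1) by omega, Nat.add_mod_right,
        Nat.mod_eq_of_lt (by omega), z1]
      decide
    · rw [Nat.mod_self, z0, Nat.mod_eq_of_lt (by omega), l4]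
      decide
  · subst h
    obtain rfl : s = 3 * q + 2 := by omega
    rw [l4, show 3 * q + 1 + 1 = 3 * q + 2 by omega, Nat.mod_self, z0,
      show 3 * q + 1 + 2 = 1 + (3 * q + 2) by omega, Nat.add_mod_right,
      Nat.mod_eq_of_lt (by omega), z1]
    decide

theorem ne_of_mem_pattern : ∀ a b c : Fin 5, ({a, b, c} : Finset (Fin 5)) ∈ pattern →
    a ≠ b ∧ a ≠ c ∧ b ≠ c := by
  decide

theorem cyclicInterval_image_label {q s : ℕ} (hq : 1 ≤ q) (hs : s = 3 * q + 1 ∨ s = 3 * q + 2)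
    (i : ZMod s) :
    ({label q i.val, label q (i + 1).val, label q (i + 2).val} : Finset (Fin 5)) ∈ pattern := by
  have : NeZero s := ⟨by omega⟩
  have h : ∀ k : ℕ, (i + (k : ZMod s)).val = (i.val + k) % s := fun k => by
    rw [← ZMod.val_natCast, Nat.cast_add, ZMod.natCast_zmod_val]
  have h1 := h 1
  have h2 := h 2
  push_cast at h1 h2
  rw [h1, h2]
  exact label_mem_pattern hq hs (ZMod.val_lt i)

theorem containsCopy_tightCycle_of_box {W : Type*} [DecidableEq W] (R : KGraph 3 W) {s : ℕ}
    (h : 3 ≤ s) (hs3 : ¬ 3 ∣ s) (F : Fin 5 → Fin s → W)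
    (hF : ∀ l l' u u', F l u = F l' u' → l = l' ∧ u = u')
    (hbox : ∀ y : Fin 5 → Fin s, ∀ e ∈ pattern, e.image (fun l => F l (y l)) ∈ R.edges) :
    R.ContainsCopy (tightCycle 3 s h) := by
  have : NeZero s := ⟨by omega⟩
  obtain ⟨q, hq, hs⟩ : ∃ q, 1 ≤ q ∧ (s = 3 * q + 1 ∨ s = 3 * q + 2) := ⟨s / 3, by omega, by omega⟩
  let idx : ZMod s → Fin s := fun i => ⟨i.val, ZMod.val_lt i⟩
  let f : ZMod s ↪ W := ⟨fun i => F (label q i.val) (idx i), fun i j hij => by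
    have := (hF _ _ _ _ hij).2
    exact ZMod.val_injective s (congrArg Fin.val this)⟩
  refine ⟨f, ?_⟩
  rintro _ ⟨i, rfl⟩
  have hp := cyclicInterval_image_label hq hs i
  obtain ⟨n1, n2, n3⟩ := ne_of_mem_pattern _ _ _ hp
  -- The three labels on an edge are distinct, so one choice of `y` realises all three vertices.
  -- Each residue keeps its own index, whence injectivity of `f`.
  have := hbox (fun l => if l = label q i.val then idx i else
    if l = label q (i + 1).val then idx (i + 1) else idx (i + 2)) _ hp
  rw [cyclicInterval_three]
  simp only [map_insert, map_singleton]
  simp only [image_insert, image_singleton, n1.symm, n2.symm, n3.symm, if_true, if_false] at this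
  exact this

/-! ### Assembling the bounds -/

theorem arrows_tightCycle_complete {s : ℕ} (h : 3 ≤ s) (hs3 : ¬ 3 ∣ s) :
    ∃ e, ∀ t, 2 ≤ t → Arrows ((t ^ t ^ 2) ^ e) (tightCycle 3 s h) (complete 3 t) := by
  classical
  -- With `N = T ^ 3` blocks the pattern density is at least `N ^ (-5) = T ^ (-15)`.
  obtain ⟨e, he⟩ := exists_box s 5 15
  refine ⟨3 + e, fun t ht => ?_⟩
  set T := t ^ t ^ 2 with hT
  have hT2 : 2 ≤ T := ht.trans (Nat.le_self_pow (by positivity) t)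
  obtain ⟨N, hN⟩ : ∃ N, N = T ^ 3 := ⟨_, rfl⟩
  obtain ⟨M, hM⟩ : ∃ M, M = T ^ e := ⟨_, rfl⟩
  rw [pow_add, ← hN, ← hM]
  intro R
  by_contra! hcon
  obtain ⟨hred, hblue⟩ := hcon
  have hgame : ∀ g : Fin N → Fin M, ∃ p : Fin 5 → Fin N, Function.Injective p ∧
      ∀ e ∈ pattern, e.image (fun l => finProdFinEquiv (p l, g (p l))) ∈ R.edges := by
    intro g
    have hinj : Function.Injective fun l : Fin N => finProdFinEquiv (l, g l) := fun a b hab =>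
      congrArg Prod.fst (finProdFinEquiv.injective hab)
    rcases exists_clique_or_pattern
      {e : Finset (Fin N) | e.image (fun l => finProdFinEquiv (l, g l)) ∈ R.edges} ht
      (by rw [Fintype.card_fin, hN, hT, ← pow_mul, ← pow_mul, mul_comm]) with
      ⟨B, hB, hBR⟩ | ⟨p, hp, hpR⟩
    · refine absurd ?_ hblue
      refine ⟨(B.orderEmbOfFin hB).toEmbedding.trans ⟨_, hinj⟩, fun e hec => ?_⟩
      have hec : e.card = 3 := hec
      refine ⟨by rw [card_map, hec], ?_⟩
      rw [← map_map, map_eq_image _ (Finset.map _ e)]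
      refine hBR _ ?_ (by rw [card_map, hec])
      intro x hx
      obtain ⟨y, _, rfl⟩ := mem_map.1 hx
      exact B.orderEmbOfFin_mem hB y
    · refine ⟨p, hp, fun e hep => ?_⟩
      have := hpR e hep
      rw [Set.mem_ofPred_eq, image_image] at this
      exact this
  obtain ⟨p, hp, hdense⟩ := exists_dense_blocks (N := N) (M := M) (by rw [hM]; positivity)
    (fun p => {u | ∀ e ∈ pattern, e.image (fun l => finProdFinEquiv (p l, u l)) ∈ R.edges})
    (fun g => by
      obtain ⟨p, hp, h⟩ := hgame g
      exact ⟨p, hp, by simpa using h⟩)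
  obtain ⟨f, hf⟩ := he T hT2 M hM.ge _ (by
    rw [show T ^ 15 = N ^ 5 by rw [hN, ← pow_mul T]]
    exact hdense)
  refine hred (containsCopy_tightCycle_of_box R h hs3
    (fun l u => finProdFinEquiv (p l, f l u)) ?_ fun y => ?_)
  · intro l l' u u' heq
    have := finProdFinEquiv.injective heq
    simp only [Prod.mk.injEq] at this
    obtain rfl := hp this.1
    exact ⟨rfl, (f l).injective this.2⟩
  · have := hf y
    simpa only [mem_filter, mem_univ, true_and] using this

end KGraph

open KGraph in
theorem theorem1 (s : ℕ) (hs : 5 ≤ s) (hs3 : ¬ 3 ∣ s) :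
    ∃ a b : ℝ, 0 < a ∧ 0 < b ∧ ∀ t : ℕ, 2 ≤ t →
      (2 : ℝ) ^ (a * (t : ℝ)) <
          (KGraph.ramsey (KGraph.tightCycle 3 s (le_trans (by norm_num) hs))
            (KGraph.complete 3 t) : ℝ) ∧
        (KGraph.ramsey (KGraph.tightCycle 3 s (le_trans (by norm_num) hs))
            (KGraph.complete 3 t) : ℝ) <
          (2 : ℝ) ^ (b * (t : ℝ) ^ 2 * Real.log (t : ℝ)) := by
  have h3 : 3 ≤ s := by omega
  obtain ⟨e, he⟩ := arrows_tightCycle_complete h3 hs3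
  have hlog2 : 0 < Real.log 2 := Real.log_pos (by norm_num)
  -- For `t ≥ 180`, `t / 360 ≤ ⌊t / 180⌋`; for smaller `t`, `2 ^ (t / 360) < 2`. Using `e + 1` makes
  -- the upper bound strict, and `log 2` converts the base.
  refine ⟨1 / 360, (e + 1) / Real.log 2, by norm_num, by positivity, fun t ht => ⟨?_, ?_⟩⟩
  · have hmem : Arrows (ramsey (tightCycle 3 s h3) (complete 3 t)) (tightCycle 3 s h3)
        (complete 3 t) :=
      -- The upper bound shows that the set is nonempty, so the infimum is not the default value 0.
      Nat.sInf_mem (s := {n | Arrows n (tightCycle 3 s h3) (complete 3 t)}) ⟨_, he t ht⟩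
    generalize ramsey (tightCycle 3 s h3) (complete 3 t) = n at hmem
    rcases lt_or_ge t 180 with ht' | ht'
    · have hn : t ≤ n := not_lt.1 fun h => not_arrows_of_lt h3 h hmem
      have hn2 : (2 : ℝ) ≤ n := by exact_mod_cast ht.trans hn
      refine lt_of_lt_of_le ?_ hn2
      have ht'' : (t : ℝ) < 180 := by exact_mod_cast ht'
      calc (2 : ℝ) ^ (1 / 360 * (t : ℝ)) < 2 ^ (1 : ℝ) :=
            Real.rpow_lt_rpow_of_exponent_lt (by norm_num) (by linarith)
        _ = 2 := Real.rpow_one 2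
    · have hn : 2 ^ (t / 180) < n := not_le.1 fun h =>
        not_arrows_of_le_two_pow h3 hs3 (by omega) h (Nat.mul_div_le t 180) hmem
      have hn' : (2 : ℝ) ^ (t / 180) < n := by exact_mod_cast hn
      refine lt_of_le_of_lt ?_ hn'
      rw [← Real.rpow_natCast]
      refine Real.rpow_le_rpow_of_exponent_le (by norm_num) ?_
      have h360 : t ≤ 360 * (t / 180) := by omega
      have : (t : ℝ) ≤ 360 * ((t / 180 : ℕ) : ℝ) := by exact_mod_cast h360
      linarith
  · have hle : ramsey (tightCycle 3 s h3) (complete 3 t) ≤ (t ^ t ^ 2) ^ e :=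
      Nat.sInf_le (he t ht)
    have hT : 2 ≤ t ^ t ^ 2 := ht.trans (Nat.le_self_pow (by positivity) t)
    have hlt := hle.trans_lt (Nat.pow_lt_pow_right hT (Nat.lt_succ_self e))
    have hpow : (2 : ℝ) ^ ((e + 1) / Real.log 2 * (t : ℝ) ^ 2 * Real.log t) =
        (((t ^ t ^ 2) ^ (e + 1) : ℕ) : ℝ) := by
      have ht0 : (0 : ℝ) < t := by positivity
      rw [Real.rpow_def_of_pos (by norm_num), ← pow_mul]
      have : Real.log 2 * ((e + 1) / Real.log 2 * (t : ℝ) ^ 2 * Real.log t) =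
          ((t ^ 2 * (e + 1) : ℕ) : ℝ) * Real.log t := by
        push_cast
        field_simp
      rw [this, Real.exp_nat_mul, Real.exp_log ht0]
      push_cast
      rfl
    rw [hpow]
    exact_mod_cast hlt
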